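/- Let $F$ be a finite 4-regular multigraph (loops and parallel edges allowed, not necessarily connected), with vertex set $V(F)$. Every edge consists of two half-edges, each incident on one vertex, and each vertex has exactly four incident half-edges. A circuit is a closed trail (a closed walk with no repeated edge), considered with its orientation and up to the choice of a starting point. A circuit partition of $F$ is a partition of $E(F)$ into edge-disjoint circuits. An Euler system of $F$ is a collection of oriented Euler circuits, one in each connected component of $F$; it is in particular a circuit partition. Let $P$ be a circuit partition. Each circuit passage of $P$ through a vertex $v$ pairs two half-edges at $v$ (a single transition of $P$); for a half-edge $h$ let $\overline h$ be the single transition of $P$ that contains $h$. The touch-graph $Tch(P)$ has the circuits of $P$ as vertices, and one edge $e_v$ for each $v\in V(F)$, whose two half-edges are the two single transitions of $P$ at $v$, each incident on the circuit to which it belongs. A closed walk $W$ in $F$ which traverses successively the edges with half-edges $h_i,h_i'$ ($1\le i\le k$, leaving a vertex along $h_i$ and reaching the next one along $h_i'$) induces the closed walk $\overline W$ in $Tch(P)$ that passes successively from $\overline{h_i'}$ to $\overline{h_{i+1}}$ (indices modulo $k$), where the indices with $\overline{h_i'}=\overline{h_{i+1}}$ are omitted. A signed version of an Euler system $C$ is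 a choice, for each $v\in V(F)$, of which of the two passages of $C$ through $v$ is called $v^+$; the other one is called $v^-$. Let $h_v^1,v^+,h_v^2$ and $h_v^3,v^-,h_v^4$ be these passages ($C$ enters $v$ along $h_v^1,h_v^3$ and leaves it along $h_v^2,h_v^4$), and let $C_1(C,v)$ be the closed walk that follows the circuit of $C$ from $v^-$ to $v^+$, leaving $v$ along $h_v^4$ and returning to $v$ along $h_v^1$. Direct each edge $e_v$ of $Tch(P)$ so that its initial half-edge is $\overline{h_v^1}$. The standard form $M^0_{\mathbb R}(C,P)$ is the $V(F)\times V(F)$ integer matrix whose $vw$ entry is the number of times that $\overline{C_1(C,v)}$ traverses $e_w$ in the chosen direction, minus the number of times that it traverses $e_w$ in the opposite direction. (It depends on the signed version of $C$, and on $P$ only through its transitions.) Lemma. Let $C$ and $C'$ be Euler systems of $F$ which respect the same set of edge directions, i.e., every edge of $F$ is traversed in the same direction by $C$ and by $C'$. Then for any signed versions of $C$ and $C'$, $$\det M^0_{\mathbb R}(C,C')=1 .$$ (The signed version of $C'$ plays no role in $M^0_{\mathbb R}(C,C')$.) -/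

import Mathlib

/-- A multigraph (loops and parallel edges allowed) with vertex set `V` and set of
half-edges `H`: `vtx h` is the vertex on which `h` is incident, and the edges are the two-element
sets `{h, opp h}`. -/
structure HalfEdgeGraph (V H : Type*) where
  vtx : H → V
  opp : H → H
  opp_opp : ∀ h, opp (opp h) = h
  opp_ne : ∀ h, opp h ≠ h

namespace HalfEdgeGraph

variable {V H : Type*} (F : HalfEdgeGraph V H)

/-- The degree of a vertex is the number of half-edges incident on it. -/
noncomputable def degree (v : V) : ℕ := Nat.card {h : H // F.vtx h = v}

def IsFourRegular : Prop := ∀ v, F.degree v = 4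

/-- The edge to which a half-edge belongs. -/
def edge (h : H) : Sym2 H := s(h, F.opp h)

/-- The simple graph obtained by forgetting loops and multiplicities of edges; it has the same
connected components. -/
def toSimple : SimpleGraph V := SimpleGraph.fromRel fun v w => ∃ h, F.vtx h = v ∧ F.vtx (F.opp h) = w

abbrev Component : Type _ := F.toSimple.ConnectedComponent

def component (v : V) : F.Component := F.toSimple.connectedComponentMk v

/-- Oriented circuits (closed trails), up to the choice of a starting point. The closed walk
`v₁, h₁, opp h₁, v₂, h₂, opp h₂, …, v₁` is recorded as the cyclic sequence `h₁, h₂, …` of the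
half-edges along which it leaves its vertices. -/
structure IsCircuit (c : Cycle H) : Prop where
  ne_nil : c ≠ Cycle.nil
  chain : c.Chain fun x y => F.vtx (F.opp x) = F.vtx y
  edges_nodup : (c.map F.edge).Nodup

/-- The circuit `c` traverses the edge of `h` (in one of the two directions). -/
def Traverses (c : Cycle H) (h : H) : Prop := h ∈ c ∨ F.opp h ∈ c

/-- `c` is an Euler circuit of the connected component `K`. -/
structure IsEulerCircuit (K : F.Component) (c : Cycle H) : Prop where
  isCircuit : F.IsCircuit c
  traverses_iff : ∀ h, F.Traverses c h ↔ F.component (F.vtx h) = K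

/-- A circuit partition: a set of circuits such that each edge belongs to exactly one of them. -/
structure CircuitPartition where
  circuits : Set (Cycle H)
  isCircuit : ∀ c ∈ circuits, F.IsCircuit c
  partition : ∀ h, ∃! c, c ∈ circuits ∧ F.Traverses c h

/-- An Euler system: one Euler circuit for each connected component. -/
structure EulerSystem where
  circuit : F.Component → Cycle H
  isEuler : ∀ K, F.IsEulerCircuit K (circuit K)

variable {F}

theorem IsCircuit.nodup {c : Cycle H} (hc : F.IsCircuit c) : c.Nodup := by
  have h := hc.edges_nodup
  clear hc
  induction c using Quotient.inductionOn with
  | _ l => exact List.Nodup.of_map _ h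

/-- An Euler system, regarded as a circuit partition. -/
def EulerSystem.toCircuitPartition (C : F.EulerSystem) : F.CircuitPartition where
  circuits := Set.range C.circuit
  isCircuit := by
    rintro _ ⟨K, rfl⟩
    exact (C.isEuler K).isCircuit
  partition := by
    intro h
    refine ⟨C.circuit (F.component (F.vtx h)),
      ⟨⟨_, rfl⟩, ((C.isEuler _).traverses_iff h).2 rfl⟩, ?_⟩
    rintro _ ⟨⟨K, rfl⟩, hK⟩
    rw [((C.isEuler K).traverses_iff h).1 hK]

/-- Two Euler systems respect the same edge directions: every edge is traversed by both of them in
the same direction. -/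
def EulerSystem.SameDirections (C C' : F.EulerSystem) : Prop :=
  ∀ h : H, (∃ K, h ∈ C.circuit K) ↔ (∃ K, h ∈ C'.circuit K)

/-- The cyclic sequence `c` contains `x` and, immediately after it, `y`. -/
def Follows [DecidableEq H] (c : Cycle H) (x y : H) : Prop :=
  ∃ (hn : c.Nodup) (hx : x ∈ c), c.next hn x hx = y

/-- `…, a, v, b, …` is a passage of a circuit of `P` through `v`, which is entered along the
half-edge `a` and left along the half-edge `b`. -/
def CircuitPartition.Passage [DecidableEq H] (P : F.CircuitPartition) (v : V) (a b : H) : Prop :=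
  F.vtx a = v ∧ F.vtx b = v ∧ ∃ c ∈ P.circuits, Follows c (F.opp a) b

/-- The single transition of `P` that involves the half-edge `h`, i.e., the set consisting of `h`
and of the half-edge with which it is paired. The two single transitions of `P` at a
vertex `v` are the two half-edges of the edge `e_v` of the touch-graph of `P`, and `P.bar` is the
2-to-1 projection from the half-edges of `F` to the half-edges of the touch-graph. -/
def CircuitPartition.bar [DecidableEq H] (P : F.CircuitPartition) (h : H) : Set H :=
  {g | g = h ∨ P.Passage (F.vtx h) h g ∨ P.Passage (F.vtx h) g h}

/-- A walk in the touch-graph of `P`, given by the list of the edges that it traverses in order;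
each of them is recorded as the pair consisting of the half-edge along which it is entered and of
the half-edge along which it is left.

This is the image of the closed walk of `F` that leaves its vertices along the half-edges
`W = [h₁, …, hₖ]`: the list of the pairs `(bar (opp hᵢ), bar hᵢ₊₁)` (indices modulo `k`), without
the pairs whose two members are equal. -/
noncomputable def CircuitPartition.project [DecidableEq H] (P : F.CircuitPartition) (W : List H) :
    List (Set H × Set H) :=
  open Classical in
  ((W.zip (W.rotate 1)).map fun p => (P.bar (F.opp p.1), P.bar p.2)).filter fun q => q.1 ≠ q.2

/-- The vector `z_D(W)` of a walk `W` in the touch-graph, where `D v` is the initial half-edge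
of the edge `e_v`: the `v` coordinate counts the passages along `e_v`, those in the direction
of `D` with sign `+` and those in the opposite direction with sign `-`. -/
noncomputable def tally (D : V → Set H) (W : List (Set H × Set H)) (v : V) : ℤ :=
  open Classical in
  (W.countP fun q => q.1 = D v : ℤ) - (W.countP fun q => q.2 = D v : ℤ)

/-- A signed version of `C`: for each vertex `v`, one of the two passages of `C` through `v` is
designated `v⁺`, and the other one `v⁻`. They are `h₁ v, v⁺, h₂ v` and `h₃ v, v⁻, h₄ v`. -/
structure SignedVersion [DecidableEq H] (C : F.EulerSystem) where
  h₁ : V → H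
  h₂ : V → H
  h₃ : V → H
  h₄ : V → H
  plus : ∀ v, C.toCircuitPartition.Passage v (h₁ v) (h₂ v)
  minus : ∀ v, C.toCircuitPartition.Passage v (h₃ v) (h₄ v)
  ne : ∀ v, h₁ v ≠ h₃ v

/-- The fundamental circuit `C₁(C, v)`, which follows the circuit of `C` incident on `v` from `v⁻`
to `v⁺`: it leaves `v` along `h₄ v` and stops when it arrives at `v` along `h₁ v`, just before the
circuit of `C` continues along `h₂ v`. -/
def SignedVersion.fundamentalCircuit [Fintype H] [DecidableEq H] {C : F.EulerSystem}
    (S : SignedVersion C) (v : V) : List H :=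
  (((C.circuit (F.component v)).formPerm (C.isEuler _).isCircuit.nodup).toList (S.h₄ v)).takeWhile
    fun h => h ≠ S.h₂ v

/-- The standard form `M⁰_ℝ(C, P)`, defined by means of a signed version of `C`. The touch-graph of
`P` is directed so that the initial half-edge of `e_v` is `bar (h₁ v)`; the `v` row is the vector
of the projection of `C₁(C, v)` to the touch-graph. -/
noncomputable def standardForm [Fintype H] [DecidableEq H] {C : F.EulerSystem}
    (S : SignedVersion C) (P : F.CircuitPartition) : Matrix V V ℤ :=
  Matrix.of fun v w => tally (fun u => P.bar (S.h₁ u)) (P.project (S.fundamentalCircuit v)) w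

end HalfEdgeGraph

open Equiv
open scoped Matrix

/-! Write `M` for the standard form. A row vector `x` gives the combination `f = ∑ x_v ·
1_{C₁(C,v)}`, a function on the half-edges along which `C` leaves its vertices, equivalently on the
edges. Along `C`, `f` drops by `x_w` at the passage `w⁺`, rises by `x_w` at `w⁻`, and is otherwise
constant. As `C'` respects the same directions, `(xM)_w` is the drop of `f` along the passage of
`C'` that enters `w` by `h₁ w` (`vecMul_standardForm`).

If `xM = 0`, then by conservation at each vertex `f` is constant along `C'`, hence on each
component, so `x = 0` (`eq_zero_of_vecMul_eq_zero`). This works over every commutative ring, in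
particular modulo every prime, so `det M = ±1`.

For the sign, let `x(sM + (1-s)I) = 0` with real `s < 1`. Where `C'` follows `C`, `(xM)_w = x_w`,
which forces `x_w = 0`; at the other vertices `x_w (xM)_w` is half the difference between the
incoming and outgoing sums of `f²`. Summed over all vertices this cancels, leaving `(1-s)∑ x_w² =
0`. So the determinant does not vanish on the segment from `I` to `M`, and `det M > 0`. -/

/-! ### Cyclic lists and arcs of permutations. -/

theorem Cycle.Chain.next {α : Type*} [DecidableEq α] {r : α → α → Prop} {c : Cycle α}
    (h : c.Chain r) (hn : c.Nodup) {x : α} (hx : x ∈ c) : r x (c.next hn x hx) := by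
  induction c using Quotient.inductionOn with
  | _ l =>
    obtain ⟨s, t, rfl⟩ := List.append_of_mem (Cycle.mem_coe_iff.1 hx)
    have e : ((s ++ x :: t : List α) : Cycle α) = ((x :: (t ++ s) : List α) : Cycle α) :=
      Cycle.coe_eq_coe.2 (by simpa using List.isRotated_append (l := s) (l' := x :: t))
    change Cycle.Chain r ((s ++ x :: t : List α) : Cycle α) at h
    change r x (Cycle.next ((s ++ x :: t : List α) : Cycle α) hn x hx)
    have hn' : Cycle.Nodup ((s ++ x :: t : List α) : Cycle α) := hn
    have hx' : x ∈ ((s ++ x :: t : List α) : Cycle α) := hx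
    change r x (Cycle.next _ hn' x hx')
    clear hn hx
    revert h hn' hx'
    rw [e]
    intro h hn hx
    rw [Cycle.chain_coe_cons] at h
    change r x (List.next (x :: (t ++ s)) x List.mem_cons_self)
    cases hts : t ++ s with
    | nil => simp [hts] at h ⊢; exact h
    | cons y u =>
      rw [hts] at h
      simp only [List.cons_append, List.isChain_cons_cons] at h
      simpa [List.next] using h.1

/-- Describes the arc from `x` up to but excluding `y` by one-step rules, so that its indicator can
be compared at `z` and `p z`. -/
theorem Equiv.Perm.mem_takeWhile_toList {α : Type*} [Fintype α] [DecidableEq α] {p : Perm α}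
    {x y : α} (hx : x ∈ p.support) (hxy : p.SameCycle x y) (hne : x ≠ y) :
    x ∈ (p.toList x).takeWhile (fun h => h ≠ y) ∧ y ∉ (p.toList x).takeWhile (fun h => h ≠ y) ∧
    ∀ z, z ∈ (p.toList x).takeWhile (fun h => h ≠ y) ↔
      p z = y ∨ (p z ∈ (p.toList x).takeWhile (fun h => h ≠ y) ∧ p z ≠ x) := by
  obtain ⟨s, t, e, hys⟩ := List.eq_append_cons_of_mem (Perm.mem_toList_iff.2 ⟨hxy, hx⟩)
  have hW : (p.toList x).takeWhile (fun h => h ≠ y) = s := by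
    rw [e, List.takeWhile_append_of_pos]
    · simp
    · intro a ha
      simpa using fun h : a = y => hys (h ▸ ha)
  rw [hW]
  have hlen : s.length < (p.toList x).length := by rw [e]; simp
  have hget : ∀ i (hi : i < s.length), s[i] = (p ^ i) x := by
    intro i hi
    rw [← Perm.getElem_toList p x i (hi.trans hlen)]
    simp [e, hi]
  have hy : (p ^ s.length) x = y := by
    rw [← Perm.getElem_toList p x _ hlen]
    simp [e]
  -- The index `s.length`, the position of `y`, is included: the orbit does not return to `x` before
  -- reaching `y`.
  have hinj : ∀ i j, i ≤ s.length → j ≤ s.length → (p ^ i) x = (p ^ j) x → i = j := by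
    intro i j hi hj h
    rw [← Perm.getElem_toList p x i (by lia), ← Perm.getElem_toList p x j (by lia)] at h
    exact (Perm.nodup_toList p x).getElem_inj_iff.1 h
  have hmem : ∀ z, z ∈ s ↔ ∃ i < s.length, (p ^ i) x = z := by
    intro z
    rw [List.mem_iff_getElem]
    constructor
    · rintro ⟨i, hi, rfl⟩; exact ⟨i, hi, (hget i hi).symm⟩
    · rintro ⟨i, hi, rfl⟩; exact ⟨i, hi, hget i hi⟩
  have hpos : 0 < s.length := by
    rcases Nat.eq_zero_or_pos s.length with h | h
    · rw [h] at hy; exact absurd hy hne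
    · exact h
  have hsucc : ∀ i, p ((p ^ i) x) = (p ^ (i + 1)) x := fun i => by rw [pow_succ', Perm.mul_apply]
  refine ⟨(hmem x).2 ⟨0, hpos, rfl⟩, hys, fun z => ⟨fun hz => ?_, ?_⟩⟩
  · obtain ⟨i, hi, rfl⟩ := (hmem z).1 hz
    rw [hsucc]
    rcases Nat.lt_or_ge (i + 1) s.length with h | h
    · refine Or.inr ⟨(hmem _).2 ⟨_, h, rfl⟩, fun h0 => ?_⟩
      have := hinj (i + 1) 0 (by lia) (by lia) (by simpa using h0)
      lia
    · left; rw [← hy]; congr; lia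
  · rintro (h | ⟨h, h0⟩)
    · refine (hmem z).2 ⟨s.length - 1, by lia, p.injective ?_⟩
      rw [hsucc, Nat.sub_add_cancel hpos, hy, h]
    · obtain ⟨i, hi, hz⟩ := (hmem _).1 h
      rcases i with - | i
      · exact absurd hz.symm h0
      · exact (hmem z).2 ⟨i, by lia, p.injective (by rw [hsucc, hz])⟩

/-! ### Euler systems as successor maps on outgoing half-edges. -/

namespace HalfEdgeGraph

variable {V H : Type*} {F : HalfEdgeGraph V H}

theorem opp_injective : Function.Injective F.opp := fun x y h => by
  rw [← F.opp_opp x, h, F.opp_opp]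

theorem IsCircuit.opp_notMem {c : Cycle H} (hc : F.IsCircuit c) {h : H} (hh : h ∈ c) :
    F.opp h ∉ c := by
  intro ho
  have hnd := hc.edges_nodup
  have he : F.edge (F.opp h) = F.edge h := by simp [edge, F.opp_opp, Sym2.eq_swap]
  clear hc
  induction c using Quotient.inductionOn with
  | _ l =>
    exact F.opp_ne h (List.inj_on_of_nodup_map (f := F.edge) hnd ho hh he)

namespace EulerSystem

variable (C : F.EulerSystem)

/-- The half-edges along which the circuits of `C` leave a vertex. -/
def IsOut (h : H) : Prop := ∃ K, h ∈ C.circuit K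

variable {C}

theorem component_of_mem {K : F.Component} {h : H} (hh : h ∈ C.circuit K) :
    F.component (F.vtx h) = K := ((C.isEuler K).traverses_iff h).1 (Or.inl hh)

theorem IsOut.mem {h : H} (hh : C.IsOut h) : h ∈ C.circuit (F.component (F.vtx h)) := by
  obtain ⟨K, hK⟩ := hh
  rwa [component_of_mem hK]

theorem IsOut.not_opp {h : H} (hh : C.IsOut h) : ¬ C.IsOut (F.opp h) := by
  rintro ⟨K, hK⟩
  have h1 : F.component (F.vtx h) = K := ((C.isEuler K).traverses_iff h).1 (Or.inr hK)
  exact (C.isEuler K).isCircuit.opp_notMem (h1 ▸ hh.mem) hK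

variable [DecidableEq H]

variable (C) in
/-- The cyclic permutation of the half-edges along which the circuit of `C` in the component `K`
leaves its vertices. -/
def perm (K : F.Component) : Perm H := (C.circuit K).formPerm (C.isEuler K).isCircuit.nodup

variable (C) in
/-- The half-edge along which `C` leaves a vertex after having traversed the edge of `h`. -/
def succ (h : H) : H := C.perm (F.component (F.vtx h)) h

theorem perm_of_mem {K : F.Component} {h : H} (hh : h ∈ C.circuit K) :
    C.perm K h = (C.circuit K).next (C.isEuler K).isCircuit.nodup h hh :=
  Cycle.formPerm_apply_mem_eq_next _ _ _ _

theorem perm_mem {K : F.Component} {h : H} (hh : h ∈ C.circuit K) :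
    C.perm K h ∈ C.circuit K := by
  rw [perm_of_mem hh]; exact Cycle.next_mem _ _ _ _

theorem succ_of_mem {K : F.Component} {h : H} (hh : h ∈ C.circuit K) :
    C.succ h = C.perm K h := by
  rw [succ, component_of_mem hh]

theorem IsOut.succ {h : H} (hh : C.IsOut h) : C.IsOut (C.succ h) :=
  ⟨_, perm_mem hh.mem⟩

theorem component_succ {h : H} (hh : C.IsOut h) :
    F.component (F.vtx (C.succ h)) = F.component (F.vtx h) :=
  component_of_mem (perm_mem hh.mem)

theorem succ_inj {x y : H} (hx : C.IsOut x) (hy : C.IsOut y) (h : C.succ x = C.succ y) :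
    x = y := by
  have hK : F.component (F.vtx x) = F.component (F.vtx y) := by
    rw [← component_succ hx, h, component_succ hy]
  rw [succ, succ, hK] at h
  exact (C.perm _).injective h

theorem vtx_succ {h : H} (hh : C.IsOut h) : F.vtx (C.succ h) = F.vtx (F.opp h) := by
  rw [succ_of_mem hh.mem, perm_of_mem hh.mem]
  exact ((C.isEuler _).isCircuit.chain.next _ hh.mem).symm

/-- Replaces cycles by the function `succ`; the condition on `F.vtx b` is automatic because circuits
are chains. -/
theorem passage_iff {v : V} {a b : H} :
    C.toCircuitPartition.Passage v a b ↔
      F.vtx a = v ∧ C.IsOut (F.opp a) ∧ C.succ (F.opp a) = b := by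
  constructor
  · rintro ⟨ha, hb, _, ⟨K, rfl⟩, hn, hx, hnext⟩
    refine ⟨ha, ⟨K, hx⟩, ?_⟩
    rw [succ_of_mem hx, perm_of_mem hx, hnext]
  · rintro ⟨ha, ho, hs⟩
    refine ⟨ha, ?_, _, ⟨F.component (F.vtx (F.opp a)), rfl⟩,
      (C.isEuler _).isCircuit.nodup, ho.mem, ?_⟩
    · rw [← hs, vtx_succ ho, F.opp_opp, ha]
    · rw [← hs, succ_of_mem ho.mem, perm_of_mem ho.mem]

theorem isOut_right_of_passage {v : V} {a b : H} (h : C.toCircuitPartition.Passage v a b) :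
    C.IsOut b := by
  obtain ⟨-, h1, rfl⟩ := passage_iff.1 h
  exact h1.succ

theorem not_isOut_left_of_passage {v : V} {a b : H} (h : C.toCircuitPartition.Passage v a b) :
    ¬ C.IsOut a := fun ha => ha.not_opp (passage_iff.1 h).2.1

/-- A single transition of an Euler system holds exactly one incoming and one outgoing half-edge, so
the incoming one determines it. -/
theorem bar_in_eq_bar_in {a b : H} (ha : C.IsOut (F.opp a)) (hb : C.IsOut (F.opp b)) :
    C.toCircuitPartition.bar a = C.toCircuitPartition.bar b ↔ a = b := by
  refine ⟨fun h => ?_, fun h => by rw [h]⟩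
  have hm : a ∈ C.toCircuitPartition.bar b := by rw [← h]; exact Or.inl rfl
  rcases hm with h | h | h
  · exact h
  · exact absurd ha (isOut_right_of_passage h).not_opp
  · exact absurd hb (isOut_right_of_passage h).not_opp

theorem bar_out_eq_bar_in {a b : H} (ha : C.IsOut a) (hb : C.IsOut (F.opp b)) :
    C.toCircuitPartition.bar a = C.toCircuitPartition.bar b ↔ a = C.succ (F.opp b) := by
  constructor
  · intro h
    have hm : a ∈ C.toCircuitPartition.bar b := by rw [← h]; exact Or.inl rfl
    rcases hm with rfl | h | h
    · exact absurd hb ha.not_opp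
    · exact (passage_iff.1 h).2.2.symm
    · exact absurd ha (not_isOut_left_of_passage h)
  · rintro h
    have hv : F.vtx a = F.vtx b := by rw [h, vtx_succ hb, F.opp_opp]
    have hp : C.toCircuitPartition.Passage (F.vtx b) b a := passage_iff.2 ⟨rfl, hb, h.symm⟩
    ext g
    simp only [CircuitPartition.bar, Set.mem_ofPred_eq, hv]
    constructor
    · rintro (rfl | h' | h')
      · exact Or.inr (Or.inl hp)
      · exact absurd ha (not_isOut_left_of_passage h')
      · left
        obtain ⟨-, h1, h2⟩ := passage_iff.1 h'
        exact opp_injective (succ_inj h1 hb (h2.trans h))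
    · rintro (rfl | h' | h')
      · exact Or.inr (Or.inr hp)
      · left; rw [h, (passage_iff.1 h').2.2]
      · exact absurd hb (isOut_right_of_passage h').not_opp

/-- A function on the half-edges that is invariant along the circuits of an Euler system is
constant on each component. -/
theorem eq_of_succ_invariant {R : Type*} {f : H → R} (hf : ∀ h, C.IsOut h → f (C.succ h) = f h)
    {x y : H} (hx : C.IsOut x) (hy : C.IsOut y)
    (hxy : F.component (F.vtx x) = F.component (F.vtx y)) [Fintype H] : f x = f y := by
  have hx' := hx.mem
  have hy' := hy.mem
  rw [← hxy] at hy'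
  generalize F.component (F.vtx x) = K at hx' hy'
  -- `formPerm` of a one-element cycle is the identity, not an `IsCycle`, so two distinct members
  -- are needed below.
  by_cases hne : x = y
  · rw [hne]
  have hnt : (C.circuit K).Nontrivial := ⟨x, y, hne, hx', hy'⟩
  have hc : (C.perm K).IsCycle := Cycle.isCycle_formPerm _ _ hnt
  have hs : (C.perm K).support = (C.circuit K).toFinset := Cycle.support_formPerm _ _ hnt
  have hmem : ∀ h, h ∈ (C.circuit K).toFinset ↔ h ∈ C.circuit K := by
    intro h
    generalize C.circuit K = c
    induction c using Quotient.inductionOn with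
    | _ l => exact List.mem_toFinset
  have hsupp : ∀ h ∈ C.circuit K, C.perm K h ≠ h := fun h hh =>
    Perm.mem_support.1 (by rw [hs, hmem]; exact hh)
  obtain ⟨n, -, -, rfl⟩ := (hc.sameCycle (hsupp x hx') (hsupp y hy')).exists_pow_eq''
  have key : ∀ n : ℕ, ((C.perm K) ^ n) x ∈ C.circuit K ∧ f (((C.perm K) ^ n) x) = f x := by
    intro n
    induction n with
    | zero => exact ⟨hx', rfl⟩
    | succ n ih =>
      rw [pow_succ', Perm.mul_apply]
      refine ⟨perm_mem ih.1, ?_⟩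
      rw [← succ_of_mem ih.1, hf _ ⟨K, ih.1⟩, ih.2]
  exact (key n).2.symm

end EulerSystem

end HalfEdgeGraph

/-! ### Counting passages in the touch-graph. -/

theorem List.countP_eq_ite_mem {α : Type*} [DecidableEq α] {l : List α} (hl : l.Nodup) (a : α)
    {p : α → Bool} (hp : ∀ x ∈ l, p x = true ↔ x = a) : l.countP p = if a ∈ l then 1 else 0 := by
  rw [← hl.count, List.count]
  exact List.countP_congr fun x hx => by rw [hp x hx, beq_iff_eq]

namespace HalfEdgeGraph

/-- A pair with equal members contributes `+1` and `-1` to the same coordinate, or nothing. -/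
theorem tally_filter {V H : Type*} (D : V → Set H) (L : List (Set H × Set H)) (v : V)
    [DecidablePred fun q : Set H × Set H => q.1 ≠ q.2] :
    tally D (L.filter fun q => q.1 ≠ q.2) v = tally D L v := by
  classical
  unfold tally
  induction L with
  | nil => simp
  | cons q L ih =>
    by_cases h : q.1 = q.2
    · rw [List.filter_cons_of_neg (by simpa using h), ih, List.countP_cons, List.countP_cons, h]
      push_cast
      ring
    · rw [List.filter_cons_of_pos (by simpa using h), List.countP_cons, List.countP_cons,
        List.countP_cons, List.countP_cons]
      push_cast
      linarith

open Classical in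
-- The pairing of arrivals with departures is immaterial: rotating `W` permutes it, so arrivals and
-- departures are counted separately.
theorem CircuitPartition.tally_project {V H : Type*} [DecidableEq H] {F : HalfEdgeGraph V H}
    (P : F.CircuitPartition) (D : V → Set H) (W : List H) (v : V) :
    tally D (P.project W) v = (W.countP fun x => P.bar (F.opp x) = D v : ℤ) -
      (W.countP fun x => P.bar x = D v : ℤ) := by
  unfold project
  rw [tally_filter]
  unfold tally
  rw [List.countP_map, List.countP_map]
  have h1 : (W.zip (W.rotate 1)).countP (fun p => decide (P.bar (F.opp p.1) = D v)) =
      W.countP fun x => decide (P.bar (F.opp x) = D v) := by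
    conv_rhs => rw [← List.map_fst_zip (l₁ := W) (l₂ := W.rotate 1) (by simp), List.countP_map]
    rfl
  have h2 : (W.zip (W.rotate 1)).countP (fun p => decide (P.bar p.2 = D v)) =
      W.countP fun x => decide (P.bar x = D v) := by
    rw [← (List.rotate_perm W 1).countP_eq]
    conv_rhs => rw [← List.map_snd_zip (l₁ := W) (l₂ := W.rotate 1) (by simp), List.countP_map]
    rfl
  exact congrArg₂ (fun a b : ℕ => (a : ℤ) - b) h1 h2

/-! ### Signed versions and fundamental circuits. -/

namespace SignedVersion

variable {V H : Type*} {F : HalfEdgeGraph V H} [DecidableEq H] {C : F.EulerSystem}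
  (S : SignedVersion C) (v w : V)

theorem isOut_opp_h₁ : C.IsOut (F.opp (S.h₁ v)) := (EulerSystem.passage_iff.1 (S.plus v)).2.1
theorem isOut_opp_h₃ : C.IsOut (F.opp (S.h₃ v)) := (EulerSystem.passage_iff.1 (S.minus v)).2.1
theorem succ_opp_h₁ : C.succ (F.opp (S.h₁ v)) = S.h₂ v := (EulerSystem.passage_iff.1 (S.plus v)).2.2
theorem succ_opp_h₃ : C.succ (F.opp (S.h₃ v)) = S.h₄ v := (EulerSystem.passage_iff.1 (S.minus v)).2.2
theorem isOut_h₂ : C.IsOut (S.h₂ v) := EulerSystem.isOut_right_of_passage (S.plus v)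
theorem isOut_h₄ : C.IsOut (S.h₄ v) := EulerSystem.isOut_right_of_passage (S.minus v)
theorem vtx_h₁ : F.vtx (S.h₁ v) = v := (S.plus v).1
theorem vtx_h₂ : F.vtx (S.h₂ v) = v := (S.plus v).2.1
theorem vtx_h₃ : F.vtx (S.h₃ v) = v := (S.minus v).1
theorem vtx_h₄ : F.vtx (S.h₄ v) = v := (S.minus v).2.1

theorem opp_h₁_ne_opp_h₃ : F.opp (S.h₁ v) ≠ F.opp (S.h₃ v) := fun h => S.ne v (opp_injective h)

theorem h₂_ne_h₄ : S.h₂ v ≠ S.h₄ v := fun h =>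
  S.opp_h₁_ne_opp_h₃ v <| EulerSystem.succ_inj (S.isOut_opp_h₁ v) (S.isOut_opp_h₃ v) <| by
    rw [succ_opp_h₁, succ_opp_h₃, h]

theorem h₂_mem : S.h₂ v ∈ C.circuit (F.component v) := by
  simpa [S.vtx_h₂] using (S.isOut_h₂ v).mem

theorem h₄_mem : S.h₄ v ∈ C.circuit (F.component v) := by
  simpa [S.vtx_h₄] using (S.isOut_h₄ v).mem

theorem h₂_eq_h₂_iff {v w : V} : S.h₂ w = S.h₂ v ↔ w = v :=
  ⟨fun h => by rw [← S.vtx_h₂ w, h, S.vtx_h₂], fun h => by rw [h]⟩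

theorem h₄_eq_h₄_iff {v w : V} : S.h₄ w = S.h₄ v ↔ w = v :=
  ⟨fun h => by rw [← S.vtx_h₄ w, h, S.vtx_h₄], fun h => by rw [h]⟩

theorem h₂_ne_h₄' (v w : V) : S.h₂ w ≠ S.h₄ v := fun h => by
  have : w = v := by rw [← S.vtx_h₂ w, h, S.vtx_h₄]
  subst this
  exact S.h₂_ne_h₄ w h

theorem eq_of_vtx_eq [Finite H] (hF : F.IsFourRegular) {h : H} (hh : F.vtx h = v) :
    h = S.h₁ v ∨ h = S.h₂ v ∨ h = S.h₃ v ∨ h = S.h₄ v := by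
  have n1 : ¬ C.IsOut (S.h₁ v) := EulerSystem.not_isOut_left_of_passage (S.plus v)
  have n3 : ¬ C.IsOut (S.h₃ v) := EulerSystem.not_isOut_left_of_passage (S.minus v)
  have n2 := S.isOut_h₂ v
  have n4 := S.isOut_h₄ v
  have h13 := S.ne v
  have h24 := S.h₂_ne_h₄ v
  have hcard : ({S.h₁ v, S.h₂ v, S.h₃ v, S.h₄ v} : Finset H).card = 4 := by
    rw [Finset.card_insert_of_notMem, Finset.card_insert_of_notMem, Finset.card_insert_of_notMem,
      Finset.card_singleton]
    · simp only [Finset.mem_singleton]; rintro e; exact n3 (e ▸ n4)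
    · simp only [Finset.mem_insert, Finset.mem_singleton, not_or]
      exact ⟨fun e => n3 (e ▸ n2), h24⟩
    · simp only [Finset.mem_insert, Finset.mem_singleton, not_or]
      exact ⟨fun e => n1 (e ▸ n2), h13, fun e => n1 (e ▸ n4)⟩
  have hsub : (({S.h₁ v, S.h₂ v, S.h₃ v, S.h₄ v} : Finset H) : Set H) ⊆ {h : H | F.vtx h = v} := by
    intro x hx
    simp only [Finset.coe_insert, Finset.coe_singleton, Set.mem_insert_iff,
      Set.mem_singleton_iff] at hx
    rcases hx with rfl | rfl | rfl | rfl
    exacts [S.vtx_h₁ v, S.vtx_h₂ v, S.vtx_h₃ v, S.vtx_h₄ v]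
  have hd : Set.ncard {h : H | F.vtx h = v} = 4 := hF v
  have heq := Set.eq_of_subset_of_ncard_le hsub
    (by rw [hd, Set.ncard_coe_finset, hcard]) (Set.toFinite _)
  have hm : h ∈ {h : H | F.vtx h = v} := hh
  rw [← heq] at hm
  simpa using hm

theorem isOut_and_vtx_eq_iff [Finite H] (hF : F.IsFourRegular) {h : H} :
    (C.IsOut h ∧ F.vtx h = v) ↔ h = S.h₂ v ∨ h = S.h₄ v := by
  constructor
  · rintro ⟨ho, hv⟩
    rcases S.eq_of_vtx_eq v hF hv with e | e | e | e
    · exact absurd (e ▸ ho) (EulerSystem.not_isOut_left_of_passage (S.plus v))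
    · exact Or.inl e
    · exact absurd (e ▸ ho) (EulerSystem.not_isOut_left_of_passage (S.minus v))
    · exact Or.inr e
  · rintro (rfl | rfl)
    exacts [⟨S.isOut_h₂ v, S.vtx_h₂ v⟩, ⟨S.isOut_h₄ v, S.vtx_h₄ v⟩]

theorem isOut_and_vtx_opp_eq_iff [Finite H] (hF : F.IsFourRegular) {h : H} :
    (C.IsOut h ∧ F.vtx (F.opp h) = v) ↔ h = F.opp (S.h₁ v) ∨ h = F.opp (S.h₃ v) := by
  constructor
  · rintro ⟨ho, hv⟩
    rcases S.eq_of_vtx_eq v hF hv with e | e | e | e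
    · left; rw [← e, F.opp_opp]
    · exact absurd (e ▸ S.isOut_h₂ v) ho.not_opp
    · right; rw [← e, F.opp_opp]
    · exact absurd (e ▸ S.isOut_h₄ v) ho.not_opp
  · rintro (rfl | rfl)
    · exact ⟨S.isOut_opp_h₁ v, by rw [F.opp_opp, S.vtx_h₁]⟩
    · exact ⟨S.isOut_opp_h₃ v, by rw [F.opp_opp, S.vtx_h₃]⟩

theorem perm_isCycle (S : SignedVersion C) (v : V) : (C.perm (F.component v)).IsCycle :=
  Cycle.isCycle_formPerm _ _ ⟨_, _, S.h₂_ne_h₄ v, S.h₂_mem v, S.h₄_mem v⟩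

variable [Fintype H]

open Classical in
-- Here the edges are grouped by their tails, and in `sum_isOut_eq_sum_h₁_h₃` by their heads;
-- comparing the two yields the cancellation of squares.
theorem sum_isOut_eq_sum_h₂_h₄ [Fintype V] {R : Type*} [AddCommMonoid R] (hF : F.IsFourRegular)
    (g : H → R) : ∑ h with C.IsOut h, g h = ∑ v, (g (S.h₂ v) + g (S.h₄ v)) := by
  rw [← Finset.sum_fiberwise _ F.vtx]
  refine Finset.sum_congr rfl fun v _ => ?_
  rw [← Finset.sum_pair (S.h₂_ne_h₄ v)]
  refine Finset.sum_congr (Finset.ext fun h => ?_) fun _ _ => rfl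
  simpa using S.isOut_and_vtx_eq_iff v hF

open Classical in
theorem sum_isOut_eq_sum_h₁_h₃ [Fintype V] {R : Type*} [AddCommMonoid R] (hF : F.IsFourRegular)
    (g : H → R) :
    ∑ h with C.IsOut h, g h = ∑ v, (g (F.opp (S.h₁ v)) + g (F.opp (S.h₃ v))) := by
  rw [← Finset.sum_fiberwise _ fun h => F.vtx (F.opp h)]
  refine Finset.sum_congr rfl fun v _ => ?_
  rw [← Finset.sum_pair (S.opp_h₁_ne_opp_h₃ v)]
  refine Finset.sum_congr (Finset.ext fun h => ?_) fun _ _ => rfl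
  simpa using S.isOut_and_vtx_opp_eq_iff v hF

/-- The circuit passes twice through `v`, so it is nontrivial. This matters because `Perm.toList` is
empty at a fixed point. -/
theorem perm_ne (S : SignedVersion C) (v : V) {h : H} (hh : h ∈ C.circuit (F.component v)) : C.perm (F.component v) h ≠ h := by
  have hs : (C.perm (F.component v)).support = (C.circuit (F.component v)).toFinset :=
    Cycle.support_formPerm _ _ ⟨_, _, S.h₂_ne_h₄ v, S.h₂_mem v, S.h₄_mem v⟩
  rw [← Perm.mem_support, hs]
  generalize C.circuit (F.component v) = c at hh
  induction c using Quotient.inductionOn with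
  | _ l => exact List.mem_toFinset.2 hh

theorem fundamentalCircuit_nodup : (S.fundamentalCircuit v).Nodup :=
  (Perm.nodup_toList _ _).sublist (List.takeWhile_sublist _)

theorem mem_circuit_of_mem_fundamentalCircuit {h : H} (hh : h ∈ S.fundamentalCircuit v) :
    h ∈ C.circuit (F.component v) := by
  by_contra hn
  have h1 := (Perm.mem_toList_iff.1 ((List.takeWhile_sublist _).subset hh)).1
  have h2 := S.perm_ne v (S.h₄_mem v)
  rw [← Perm.mem_support] at h2
  exact Perm.mem_support.1 (h1.mem_support_iff.1 h2) (Cycle.formPerm_eq_self_of_notMem _ _ _ hn)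

/-- The indicator of an arc changes only at its two ends: just before `h₂ v`, where it stops, and at
`h₄ v`, where it starts. -/
theorem mem_fundamentalCircuit_sub {h : H} (ho : C.IsOut h) :
    (if h ∈ S.fundamentalCircuit v then 1 else 0 : ℤ) -
        (if C.succ h ∈ S.fundamentalCircuit v then 1 else 0) =
      (if C.succ h = S.h₂ v then 1 else 0) - (if C.succ h = S.h₄ v then 1 else 0) := by
  obtain ⟨hx, hy, hz⟩ := Perm.mem_takeWhile_toList (p := C.perm (F.component v))
    (Perm.mem_support.2 (S.perm_ne v (S.h₄_mem v)))
    ((S.perm_isCycle v).sameCycle (S.perm_ne v (S.h₄_mem v)) (S.perm_ne v (S.h₂_mem v)))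
    (S.h₂_ne_h₄ v).symm
  change S.h₄ v ∈ S.fundamentalCircuit v at hx
  change S.h₂ v ∉ S.fundamentalCircuit v at hy
  change ∀ z, z ∈ S.fundamentalCircuit v ↔ C.perm (F.component v) z = S.h₂ v ∨
    (C.perm (F.component v) z ∈ S.fundamentalCircuit v ∧ C.perm (F.component v) z ≠ S.h₄ v) at hz
  by_cases hc : F.component (F.vtx h) = F.component v
  · have hs : C.succ h = C.perm (F.component v) h := by rw [EulerSystem.succ, hc]
    have hne := S.h₂_ne_h₄ v
    specialize hz h
    rw [← hs] at hz
    by_cases h2 : C.succ h = S.h₂ v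
    · simp [hz, h2, hy, hne]
    · by_cases h4 : C.succ h = S.h₄ v
      · simp [hz, h4, hx, hne.symm]
      · simp [hz, h2, h4]
  -- In another component all four indicators vanish.
  · have hK : ∀ x ∈ C.circuit (F.component v), F.component (F.vtx x) = F.component v :=
      fun x => EulerSystem.component_of_mem
    have hsK := EulerSystem.component_succ ho
    rw [if_neg fun hm => hc (hK _ (S.mem_circuit_of_mem_fundamentalCircuit v hm)),
      if_neg fun hm => hc (hsK.symm.trans (hK _ (S.mem_circuit_of_mem_fundamentalCircuit v hm))),
      if_neg fun hm => hc (hsK.symm.trans (hK _ (by rw [hm]; exact S.h₂_mem v))),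
      if_neg fun hm => hc (hsK.symm.trans (hK _ (by rw [hm]; exact S.h₄_mem v)))]

theorem opp_h₁_mem_sub_h₂_mem [DecidableEq V] :
    (if F.opp (S.h₁ w) ∈ S.fundamentalCircuit v then 1 else 0 : ℤ) -
        (if S.h₂ w ∈ S.fundamentalCircuit v then 1 else 0) = if w = v then 1 else 0 := by
  have := S.mem_fundamentalCircuit_sub v (S.isOut_opp_h₁ w)
  rw [S.succ_opp_h₁, if_neg (S.h₂_ne_h₄' v w), sub_zero] at this
  simpa only [S.h₂_eq_h₂_iff] using this

theorem opp_h₃_mem_sub_h₄_mem [DecidableEq V] :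
    (if F.opp (S.h₃ w) ∈ S.fundamentalCircuit v then 1 else 0 : ℤ) -
        (if S.h₄ w ∈ S.fundamentalCircuit v then 1 else 0) = -if w = v then 1 else 0 := by
  have := S.mem_fundamentalCircuit_sub v (S.isOut_opp_h₃ w)
  rw [S.succ_opp_h₃, if_neg (S.h₂_ne_h₄' w v).symm, zero_sub] at this
  simpa only [S.h₄_eq_h₄_iff] using this

/-- With equal directions the arc leaves vertices only along outgoing half-edges of `C'`. Hence just
one member of the arc can arrive in the transition `bar (h₁ w)` and just one can depart from it,
each at most once. -/
theorem standardForm_apply {C' : F.EulerSystem} (hdir : C.SameDirections C') :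
    standardForm S C'.toCircuitPartition v w =
      (if F.opp (S.h₁ w) ∈ S.fundamentalCircuit v then 1 else 0 : ℤ) -
        (if C'.succ (F.opp (S.h₁ w)) ∈ S.fundamentalCircuit v then 1 else 0) := by
  classical
  have hW : ∀ x ∈ S.fundamentalCircuit v, C'.IsOut x := fun x hx =>
    (hdir x).1 ⟨_, S.mem_circuit_of_mem_fundamentalCircuit v hx⟩
  have hw : C'.IsOut (F.opp (S.h₁ w)) := (hdir _).1 (S.isOut_opp_h₁ w)
  rw [standardForm, Matrix.of_apply, CircuitPartition.tally_project,
    List.countP_eq_ite_mem (S.fundamentalCircuit_nodup v) (F.opp (S.h₁ w)),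
    List.countP_eq_ite_mem (S.fundamentalCircuit_nodup v) (C'.succ (F.opp (S.h₁ w)))]
  · push_cast; rfl
  · intro x hx
    rw [decide_eq_true_iff, EulerSystem.bar_out_eq_bar_in (hW x hx) hw]
  · intro x hx
    rw [decide_eq_true_iff, EulerSystem.bar_in_eq_bar_in (by rw [F.opp_opp]; exact hW x hx) hw]
    exact ⟨fun h => by rw [← h, F.opp_opp], fun h => by rw [h, F.opp_opp]⟩

end SignedVersion
end HalfEdgeGraph

/-! ### Determinant criteria. -/

/-- An integer matrix that is nonsingular modulo every prime is invertible over the integers. -/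
theorem Matrix.isUnit_det_of_forall_prime {n : Type*} [Fintype n] [DecidableEq n]
    (M : Matrix n n ℤ) (h : ∀ (p : ℕ) [Fact p.Prime] (x : n → ZMod p),
      x ᵥ* M.map (Int.cast : ℤ → ZMod p) = 0 → x = 0) : IsUnit M.det := by
  rw [Int.isUnit_iff_natAbs_eq]
  by_contra hne
  obtain ⟨p, hp, hd⟩ := Nat.exists_prime_and_dvd hne
  have := Fact.mk hp
  have h0 : (M.map (Int.cast : ℤ → ZMod p)).det = 0 := by
    have := (Int.castRingHom (ZMod p)).map_det M
    rw [RingHom.mapMatrix_apply] at this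
    change (M.map (Int.castRingHom (ZMod p))).det = 0
    rw [← this]
    exact (ZMod.intCast_zmod_eq_zero_iff_dvd _ _).2 (Int.natCast_dvd.2 hd)
  obtain ⟨x, hx, hx0⟩ := Matrix.exists_vecMul_eq_zero_iff.2 h0
  exact hx (h p x hx0)

/-- If no matrix on the segment from the identity to `M` is singular, then `M` has positive
determinant. -/
theorem Matrix.det_pos_of_segment {n : Type*} [Fintype n] [DecidableEq n] (M : Matrix n n ℝ)
    (h : ∀ s ∈ Set.Icc (0 : ℝ) 1, ∀ x, x ᵥ* (s • M + (1 - s) • 1) = 0 → x = 0) :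
    0 < M.det := by
  have hne : ∀ s ∈ Set.Icc (0 : ℝ) 1, (s • M + (1 - s) • 1).det ≠ 0 := by
    intro s hs h0
    obtain ⟨x, hx, hx0⟩ := Matrix.exists_vecMul_eq_zero_iff.2 h0
    exact hx (h s hs x hx0)
  have hc : ContinuousOn (fun s : ℝ => (s • M + (1 - s) • 1).det) (Set.Icc 0 1) := by
    refine Continuous.continuousOn ?_
    refine Continuous.matrix_det ?_
    fun_prop
  by_contra hle
  -- The determinant is `1` at `s = 0` and, by assumption, at most `0` at `s = 1`.
  have hmem : (0 : ℝ) ∈ Set.Icc ((1 : ℝ) • M + (1 - 1 : ℝ) • 1).det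
      ((0 : ℝ) • M + (1 - 0 : ℝ) • 1).det := by
    constructor
    · simpa using hle
    · simp
  obtain ⟨s, hs, h0⟩ := intermediate_value_Icc' zero_le_one hc hmem
  exact hne s hs h0

/-! ### Nonsingularity of the standard form and of the segment to the identity. -/

namespace HalfEdgeGraph.SignedVersion

variable {V H : Type*} [Fintype H] [DecidableEq H] {F : HalfEdgeGraph V H}
  {C C' : F.EulerSystem} (S : SignedVersion C)

/-- Where `C'` follows the circuits of `C` it pairs the half-edges at `w` as `C` does; elsewhere,
it exchanges the half-edges along which `C` leaves `w`. -/
theorem succ_cases (w : V) (hF : F.IsFourRegular) (hdir : C.SameDirections C') :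
    (C'.succ (F.opp (S.h₁ w)) = S.h₂ w ∧ C'.succ (F.opp (S.h₃ w)) = S.h₄ w) ∨
      (C'.succ (F.opp (S.h₁ w)) = S.h₄ w ∧ C'.succ (F.opp (S.h₃ w)) = S.h₂ w) := by
  have h1 : C'.IsOut (F.opp (S.h₁ w)) := (hdir _).1 (S.isOut_opp_h₁ w)
  have h3 : C'.IsOut (F.opp (S.h₃ w)) := (hdir _).1 (S.isOut_opp_h₃ w)
  have e1 := (S.isOut_and_vtx_eq_iff w hF).1 ⟨(hdir _).2 h1.succ,
    by rw [EulerSystem.vtx_succ h1, F.opp_opp, S.vtx_h₁]⟩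
  have e3 := (S.isOut_and_vtx_eq_iff w hF).1 ⟨(hdir _).2 h3.succ,
    by rw [EulerSystem.vtx_succ h3, F.opp_opp, S.vtx_h₃]⟩
  have hne : C'.succ (F.opp (S.h₁ w)) ≠ C'.succ (F.opp (S.h₃ w)) := fun h =>
    S.opp_h₁_ne_opp_h₃ w (EulerSystem.succ_inj h1 h3 h)
  rcases e1 with e1 | e1 <;> rcases e3 with e3 | e3
  · exact absurd (e1.trans e3.symm) hne
  · exact Or.inl ⟨e1, e3⟩
  · exact Or.inr ⟨e1, e3⟩
  · exact absurd (e1.trans e3.symm) hne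

variable [Fintype V] {R : Type*} [CommRing R] (x : V → R) (w : V)

/-- The linear combination of the fundamental circuits with coefficients `x`, as a function on the
half-edges. -/
def combination (h : H) : R := ∑ v, x v * if h ∈ S.fundamentalCircuit v then 1 else 0

theorem vecMul_standardForm (hdir : C.SameDirections C') :
    (x ᵥ* (standardForm S C'.toCircuitPartition).map (Int.cast : ℤ → R)) w =
      S.combination x (F.opp (S.h₁ w)) - S.combination x (C'.succ (F.opp (S.h₁ w))) := by
  simp only [Matrix.vecMul, dotProduct, Matrix.map_apply, S.standardForm_apply _ _ hdir,
    combination, ← Finset.sum_sub_distrib, ← mul_sub]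
  push_cast
  rfl

variable [DecidableEq V]

theorem combination_opp_h₁ :
    S.combination x (F.opp (S.h₁ w)) = S.combination x (S.h₂ w) + x w := by
  have h : ∀ v, (if F.opp (S.h₁ w) ∈ S.fundamentalCircuit v then 1 else 0 : R) =
      (if S.h₂ w ∈ S.fundamentalCircuit v then 1 else 0) + if w = v then 1 else 0 := fun v => by
    have := congrArg (Int.cast : ℤ → R) (S.opp_h₁_mem_sub_h₂_mem v w)
    push_cast at this
    rw [← this]; ring
  simp [combination, h, mul_add, Finset.sum_add_distrib]

theorem combination_opp_h₃ :
    S.combination x (F.opp (S.h₃ w)) = S.combination x (S.h₄ w) - x w := by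
  have h : ∀ v, (if F.opp (S.h₃ w) ∈ S.fundamentalCircuit v then 1 else 0 : R) =
      (if S.h₄ w ∈ S.fundamentalCircuit v then 1 else 0) - if w = v then 1 else 0 := fun v => by
    have := congrArg (Int.cast : ℤ → R) (S.opp_h₃_mem_sub_h₄_mem v w)
    push_cast at this
    rw [sub_eq_add_neg, ← this]; ring
  simp [combination, h, mul_sub, Finset.sum_sub_distrib]

/-- A null vector makes the combination constant along `C'`, hence on components, whereas its drop
at `w⁺` is `x w`. -/
theorem eq_zero_of_vecMul_eq_zero (hF : F.IsFourRegular) (hdir : C.SameDirections C')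
    (h : x ᵥ* (standardForm S C'.toCircuitPartition).map (Int.cast : ℤ → R) = 0) : x = 0 := by
  have h1 : ∀ w, S.combination x (C'.succ (F.opp (S.h₁ w))) =
      S.combination x (F.opp (S.h₁ w)) := fun w =>
    (sub_eq_zero.1 (by rw [← S.vecMul_standardForm x w hdir, h]; rfl)).symm
  -- Incoming and outgoing values at `w` have equal sums, so invariance along one passage of `C'`
  -- gives it along the other.
  have h3 : ∀ w, S.combination x (C'.succ (F.opp (S.h₃ w))) =
      S.combination x (F.opp (S.h₃ w)) := by
    intro w
    have e1 := h1 w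
    have e2 := S.combination_opp_h₁ x w
    have e3 := S.combination_opp_h₃ x w
    rcases S.succ_cases w hF hdir with ⟨s1, s3⟩ | ⟨s1, s3⟩ <;> rw [s1] at e1 <;> rw [s3] <;>
      linear_combination -e1 - e2 - e3
  have hinv : ∀ h, C'.IsOut h → S.combination x (C'.succ h) = S.combination x h := by
    intro h ho
    rcases (S.isOut_and_vtx_opp_eq_iff _ hF).1 ⟨(hdir h).2 ho, rfl⟩ with e | e <;> rw [e]
    exacts [h1 _, h3 _]
  funext w
  have hK : F.component (F.vtx (F.opp (S.h₁ w))) = F.component (F.vtx (S.h₂ w)) := by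
    rw [← S.succ_opp_h₁ w, EulerSystem.component_succ (S.isOut_opp_h₁ w)]
  have := EulerSystem.eq_of_succ_invariant hinv ((hdir _).1 (S.isOut_opp_h₁ w))
    ((hdir _).1 (S.isOut_h₂ w)) hK
  rw [S.combination_opp_h₁] at this
  simpa using this

/-- On vectors supported where `C'` departs from `C`, the quadratic form of the matrix vanishes, as
for a skew-symmetric matrix. -/
theorem sum_mul_vecMul_eq_zero (hF : F.IsFourRegular) (hdir : C.SameDirections C') (x : V → ℝ)
    (hx : ∀ w, C'.succ (F.opp (S.h₁ w)) = S.h₂ w → x w = 0) :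
    ∑ w, x w * (x ᵥ* (standardForm S C'.toCircuitPartition).map (Int.cast : ℤ → ℝ)) w = 0 := by
  set f := S.combination x with hf
  -- Every edge contributes its square once at its head and once at its tail.
  have hsum : ∑ w, (f (F.opp (S.h₁ w)) ^ 2 + f (F.opp (S.h₃ w)) ^ 2 -
      (f (S.h₂ w) ^ 2 + f (S.h₄ w) ^ 2)) = 0 := by
    rw [Finset.sum_sub_distrib, ← S.sum_isOut_eq_sum_h₁_h₃ hF fun h => f h ^ 2,
      ← S.sum_isOut_eq_sum_h₂_h₄ hF fun h => f h ^ 2, sub_self]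
  have : ∀ w, x w * (x ᵥ* (standardForm S C'.toCircuitPartition).map (Int.cast : ℤ → ℝ)) w =
      1 / 2 * (f (F.opp (S.h₁ w)) ^ 2 + f (F.opp (S.h₃ w)) ^ 2 -
        (f (S.h₂ w) ^ 2 + f (S.h₄ w) ^ 2)) := by
    intro w
    rw [S.vecMul_standardForm x w hdir, ← hf]
    have e1 := S.combination_opp_h₁ x w
    have e3 := S.combination_opp_h₃ x w
    rw [← hf] at e1 e3
    rcases S.succ_cases w hF hdir with ⟨s1, -⟩ | ⟨s1, -⟩ <;> rw [s1]
    · rw [e1, e3, hx w s1]; ring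
    · rw [e1, e3]; ring
  rw [Finset.sum_congr rfl fun w _ => this w, ← Finset.mul_sum, hsum, mul_zero]

theorem eq_zero_of_vecMul_segment_eq_zero (hF : F.IsFourRegular) (hdir : C.SameDirections C')
    {s : ℝ} (hs : s ≤ 1) (x : V → ℝ)
    (h : x ᵥ* (s • (standardForm S C'.toCircuitPartition).map (Int.cast : ℤ → ℝ) +
      (1 - s) • 1) = 0) : x = 0 := by
  rcases hs.eq_or_lt with rfl | hs
  · exact S.eq_zero_of_vecMul_eq_zero x hF hdir (by simpa using h)
  have hw : ∀ w, s * (x ᵥ* (standardForm S C'.toCircuitPartition).map (Int.cast : ℤ → ℝ)) w +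
      (1 - s) * x w = 0 := by
    intro w
    have := congrFun h w
    simpa [Matrix.vecMul_add, Matrix.vecMul_smul] using this
  -- Here `(xM)_w = x_w`, so the equation reads `s x_w + (1-s) x_w = 0`.
  have hx : ∀ w, C'.succ (F.opp (S.h₁ w)) = S.h₂ w → x w = 0 := by
    intro w e
    have := hw w
    rw [S.vecMul_standardForm x w hdir, e, S.combination_opp_h₁] at this
    linear_combination this
  have hsum := S.sum_mul_vecMul_eq_zero hF hdir x hx
  -- Pair the null equation with `x`; the part coming from the standard form drops out.
  have hsq : (1 - s) * ∑ w, x w * x w = 0 := by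
    calc (1 - s) * ∑ w, x w * x w
        = (1 - s) * ∑ w, x w * x w + s * ∑ w, x w *
          (x ᵥ* (standardForm S C'.toCircuitPartition).map (Int.cast : ℤ → ℝ)) w := by
            rw [hsum]; ring
      _ = 0 := by
        rw [Finset.mul_sum, Finset.mul_sum, ← Finset.sum_add_distrib]
        exact Finset.sum_eq_zero fun w _ => by linear_combination x w * hw w
  have h0 := (mul_eq_zero.1 hsq).resolve_left (by linarith)
  exact dotProduct_self_eq_zero.1 h0

end HalfEdgeGraph.SignedVersion

theorem mainTheorem7 {V H : Type*} [Fintype V] [DecidableEq V] [Fintype H] [DecidableEq H]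
    (F : HalfEdgeGraph V H) (hF : F.IsFourRegular)
    (C C' : F.EulerSystem) (hdir : C.SameDirections C')
    (S : HalfEdgeGraph.SignedVersion C) :
    (HalfEdgeGraph.standardForm S C'.toCircuitPartition).det = 1 := by
  have hunit := Matrix.isUnit_det_of_forall_prime (HalfEdgeGraph.standardForm S C'.toCircuitPartition)
    fun p _ x hx => S.eq_zero_of_vecMul_eq_zero x hF hdir hx
  have hpos := Matrix.det_pos_of_segment _ fun s hs x hx =>
    S.eq_zero_of_vecMul_segment_eq_zero hF hdir (C' := C') hs.2 x hx
  have hcast := (Int.castRingHom ℝ).map_det (HalfEdgeGraph.standardForm S C'.toCircuitPartition)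
  rw [RingHom.mapMatrix_apply] at hcast
  change _ = Matrix.det (Matrix.map _ (Int.cast : ℤ → ℝ)) at hcast
  rw [← hcast] at hpos
  rcases Int.isUnit_iff.1 hunit with h | h
  · exact h
  · rw [h] at hpos
    norm_num at hpos
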